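/- Let $f:(0,\infty)\to(0,\infty)$ be continuous and suppose that $\lim_{s\to\infty}e^{as}f(s)=\infty$ for every $a>0$. Let $\Omega\subseteq\mathbb{R}^2$ be an exterior domain, i.e. a nonempty connected open set whose complement is compact. Then the inequality $$-\Delta u\ \ge\ f(u)$$ has no positive solution in $\Omega$, in any of the following three senses. 1. Classical: there is no $u\in C^2(\Omega)$ with $u>0$ in $\Omega$ and $-\Delta u(x)\ge f(u(x))$ for every $x\in\Omega$. 2. Weak (Sobolev): there is no $u\in W^{1,2}_{\mathrm{loc}}(\Omega)$ with $u>0$ almost everywhere in $\Omega$ such that, for every nonnegative $\varphi\in C_0^\infty(\Omega)$, the function $f(u)\varphi$ is integrable over $\Omega$ and $$\int_\Omega Du\cdot D\varphi\,dx\ \ge\ \int_\Omega f(u)\,\varphi\,dx .$$ 3. Viscosity: there is no lower semicontinuous $u:\Omega\to(0,\infty)$ such that $-\Delta\varphi(x_0)\ge f(u(x_0))$ whenever $x_0\in\Omega$, $\varphi\in C^2(\Omega)$ and $u-\varphi$ has a local minimum at $x_0$. -/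

import Mathlib

open MeasureTheory Filter Topology
open scoped InnerProductSpace Laplacian ContDiff

/-- An exterior domain of `ℝⁿ`: a nonempty connected open set whose complement is compact. -/
def IsExteriorDomain {n : ℕ} (Ω : Set (EuclideanSpace ℝ (Fin n))) : Prop :=
  IsOpen Ω ∧ IsConnected Ω ∧ IsCompact Ωᶜ

/-- Test functions `φ ∈ C₀^∞(Ω)`. -/
def IsTestFunction {n : ℕ} (Ω : Set (EuclideanSpace ℝ (Fin n)))
    (φ : EuclideanSpace ℝ (Fin n) → ℝ) : Prop :=
  ContDiff ℝ ∞ φ ∧ HasCompactSupport φ ∧ tsupport φ ⊆ Ω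

/-- `g ∈ L²_loc(Ω)`. -/
def MemL2Loc {n : ℕ} {F : Type*} [NormedAddCommGroup F] (Ω : Set (EuclideanSpace ℝ (Fin n)))
    (g : EuclideanSpace ℝ (Fin n) → F) : Prop :=
  ∀ K : Set (EuclideanSpace ℝ (Fin n)), IsCompact K → K ⊆ Ω → MemLp g 2 (volume.restrict K)

/-- `G` is the weak (distributional) gradient of `u` in `Ω`. -/
def IsWeakGradient {n : ℕ} (Ω : Set (EuclideanSpace ℝ (Fin n)))
    (u : EuclideanSpace ℝ (Fin n) → ℝ)
    (G : EuclideanSpace ℝ (Fin n) → EuclideanSpace ℝ (Fin n)) : Prop :=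
  ∀ φ : EuclideanSpace ℝ (Fin n) → ℝ, IsTestFunction Ω φ → ∀ i : Fin n,
    ∫ x in Ω, u x * fderiv ℝ φ x (EuclideanSpace.single i 1) = - ∫ x in Ω, G x i * φ x

/-- `-Δu ≥ f(u)` in `Ω` in the classical sense: `u ∈ C²(Ω)` and the inequality holds pointwise. -/
def IsClassicalSupersolution {n : ℕ} (f : ℝ → ℝ) (Ω : Set (EuclideanSpace ℝ (Fin n)))
    (u : EuclideanSpace ℝ (Fin n) → ℝ) : Prop :=
  ContDiffOn ℝ 2 u Ω ∧ ∀ x ∈ Ω, f (u x) ≤ -(Δ u) x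

/-- `-Δu ≥ f(u)` in `Ω` in the weak Sobolev sense: `u ∈ W^{1,2}_loc(Ω)` and
`∫ Du · Dφ ≥ ∫ f(u) φ` for every nonnegative test function `φ`. The integral on the right is
required to converge; for nonnegative `f(u)` this is automatic if it is read in `[0, ∞]`. -/
def IsWeakSupersolution {n : ℕ} (f : ℝ → ℝ) (Ω : Set (EuclideanSpace ℝ (Fin n)))
    (u : EuclideanSpace ℝ (Fin n) → ℝ) : Prop :=
  MemL2Loc Ω u ∧ ∃ G : EuclideanSpace ℝ (Fin n) → EuclideanSpace ℝ (Fin n),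
    MemL2Loc Ω G ∧ IsWeakGradient Ω u G ∧
    ∀ φ : EuclideanSpace ℝ (Fin n) → ℝ, IsTestFunction Ω φ → (∀ x, 0 ≤ φ x) →
      IntegrableOn (fun x => f (u x) * φ x) Ω ∧
      ∫ x in Ω, f (u x) * φ x ≤ ∫ x in Ω, ⟪G x, gradient φ x⟫_ℝ

/-- `-Δu ≥ f(u)` in `Ω` in the viscosity sense: `u` is lower semicontinuous in `Ω`, and
`-Δφ(x₀) ≥ f(u(x₀))` whenever `φ ∈ C²(Ω)` and `u - φ` has a local minimum at `x₀ ∈ Ω`. -/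
def IsViscositySupersolution {n : ℕ} (f : ℝ → ℝ) (Ω : Set (EuclideanSpace ℝ (Fin n)))
    (u : EuclideanSpace ℝ (Fin n) → ℝ) : Prop :=
  LowerSemicontinuousOn u Ω ∧
  ∀ x₀ ∈ Ω, ∀ φ : EuclideanSpace ℝ (Fin n) → ℝ, ContDiffOn ℝ 2 φ Ω →
    IsLocalMin (fun x => u x - φ x) x₀ → f (u x₀) ≤ -(Δ φ) x₀

/-! Write `s = log ‖x‖²`. In the plane `s` is harmonic off the origin and tends to infinity, and
`s²` has Laplacian `8 / ‖x‖²`, so quadratic polynomials in `s` serve as barriers on annuli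
(`quadratic_log_le`). Affine barriers show two things about a positive superharmonic `u` near
infinity: it is bounded below by a positive constant (`exists_pos_le_of_superharmonic`), and its
minima over circles grow at most linearly in `s`, with some slope `M`.

The lower bound keeps `u` away from `0`, so the growth hypothesis allows `f` to be replaced by `c
exp(-a s)` for any `a > 0` (`exists_exp_le`). With `a = 1 / M`, at circle minima `c exp(-a u)` is at
least a constant multiple of `1 / ‖x‖²`. Barriers concave in `s`, vanishing on both boundary circles
of an annulus, then lie below `u`. As the outer radius grows they tend to infinity at a fixed point,
which is absurd (`false_of_exp_bound`).

Classical and viscosity supersolutions fit this directly. A weak supersolution is mollified at scale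
`1`. Since `c exp(-a s)` is convex, Jensen's inequality (`exp_mollify_le`) gives the mollification
the same exponential inequality. This needs an almost everywhere positive lower bound for `u`
itself, which follows because mollifications of a superharmonic distribution increase to `u` as the
scale shrinks (`mollify_antitoneOn`, `ae_tendsto_mollify`). -/

/-! ### Laplacians of radial functions and second-order conditions at minima -/

theorem laplacian_eq_sum_fderiv_fderiv {n : ℕ} (φ : EuclideanSpace ℝ (Fin n) → ℝ)
    (x : EuclideanSpace ℝ (Fin n)) :
    (Δ φ) x = ∑ i, fderiv ℝ (fderiv ℝ φ) x (EuclideanSpace.single i 1)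
      (EuclideanSpace.single i 1) := by
  rw [InnerProductSpace.laplacian_eq_iteratedFDeriv_orthonormalBasis φ
    (EuclideanSpace.basisFun (Fin n) ℝ)]
  simp [iteratedFDeriv_two_apply]

theorem ContDiffAt.laplacian_eq_sum {n : ℕ} {φ : EuclideanSpace ℝ (Fin n) → ℝ}
    {x : EuclideanSpace ℝ (Fin n)} (hφ : ContDiffAt ℝ 2 φ x) :
    (Δ φ) x = ∑ i, fderiv ℝ (fun y => fderiv ℝ φ y (EuclideanSpace.single i 1)) x
      (EuclideanSpace.single i 1) := by
  rw [laplacian_eq_sum_fderiv_fderiv]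
  have h : DifferentiableAt ℝ (fderiv ℝ φ) x :=
    (hφ.fderiv_right (m := 1) (by norm_num)).differentiableAt one_ne_zero
  refine Finset.sum_congr rfl fun i _ => ?_
  rw [fderiv_clm_apply h (by fun_prop)]
  simp

theorem hasFDerivAt_norm_sub_sq {n : ℕ} (a x : EuclideanSpace ℝ (Fin n)) :
    HasFDerivAt (fun y => ‖y - a‖ ^ 2) (2 • innerSL ℝ (x - a)) x := by
  simpa using ((hasFDerivAt_id x).sub_const a).norm_sq

/-- The Laplacian of a radial function, as a function of the squared radius. -/
theorem laplacian_comp_norm_sub_sq {n : ℕ} {h : ℝ → ℝ} {a x : EuclideanSpace ℝ (Fin n)}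
    (hh : ContDiffAt ℝ 2 h (‖x - a‖ ^ 2)) :
    (Δ fun y => h (‖y - a‖ ^ 2)) x =
      4 * ‖x - a‖ ^ 2 * deriv (deriv h) (‖x - a‖ ^ 2) + 2 * n * deriv h (‖x - a‖ ^ 2) := by
  have hq : ContDiff ℝ 2 (fun y : EuclideanSpace ℝ (Fin n) => ‖y - a‖ ^ 2) :=
    (contDiff_id.sub contDiff_const).norm_sq ℝ
  have hc : ContDiffAt ℝ 2 (fun y : EuclideanSpace ℝ (Fin n) => h (‖y - a‖ ^ 2)) x :=
    ContDiffAt.comp x hh hq.contDiffAt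
  rw [hc.laplacian_eq_sum]
  have h1 : ∀ᶠ y in 𝓝 x, ContDiffAt ℝ 2 h (‖y - a‖ ^ 2) :=
    hq.continuous.continuousAt.eventually (hh.eventually (by simp))
  have hd : DifferentiableAt ℝ (deriv h) (‖x - a‖ ^ 2) := by
    have h1 : DifferentiableAt ℝ (fderiv ℝ h) (‖x - a‖ ^ 2) :=
      (hh.fderiv_right (m := 1) (by norm_num)).differentiableAt one_ne_zero
    exact h1.clm_apply (differentiableAt_const 1)
  have h2 : ∀ i : Fin n, fderiv ℝ (fun y => fderiv ℝ
      (fun y : EuclideanSpace ℝ (Fin n) => h (‖y - a‖ ^ 2)) y (EuclideanSpace.single i 1)) x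
      (EuclideanSpace.single i 1) =
      4 * (x i - a i) ^ 2 * deriv (deriv h) (‖x - a‖ ^ 2) + 2 * deriv h (‖x - a‖ ^ 2) := by
    intro i
    have h3 : (fun y => fderiv ℝ (fun y : EuclideanSpace ℝ (Fin n) => h (‖y - a‖ ^ 2)) y
        (EuclideanSpace.single i 1)) =ᶠ[𝓝 x]
        fun y => deriv h (‖y - a‖ ^ 2) * (2 * (y i - a i)) := by
      filter_upwards [h1] with y hy
      have : HasFDerivAt (fun y => h (‖y - a‖ ^ 2)) _ y :=
        (hy.differentiableAt two_ne_zero).hasDerivAt.comp_hasFDerivAt y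
        (hasFDerivAt_norm_sub_sq a y)
      rw [HasFDerivAt.fderiv this]
      simp [EuclideanSpace.inner_single_right]
    rw [h3.fderiv_eq]
    have h4 := hd.hasDerivAt.comp_hasFDerivAt x (hasFDerivAt_norm_sub_sq a x)
    have h5 : HasFDerivAt (fun y : EuclideanSpace ℝ (Fin n) => 2 * (y i - a i))
        ((2 : ℝ) • (EuclideanSpace.proj i : EuclideanSpace ℝ (Fin n) →L[ℝ] ℝ)) x :=
      ((EuclideanSpace.proj i : EuclideanSpace ℝ (Fin n) →L[ℝ] ℝ).hasFDerivAt.sub_const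
        (a i)).const_mul 2
    have h6 := h4.mul h5
    simp only [Function.comp_def] at h6
    have h7 := h6.fderiv
    simp only [Pi.mul_def] at h7
    rw [h7]
    simp [EuclideanSpace.inner_single_right]
    ring
  simp only [h2, Finset.sum_add_distrib, ← Finset.sum_mul, ← Finset.mul_sum]
  rw [EuclideanSpace.norm_sq_eq]
  simp only [PiLp.sub_apply, Real.norm_eq_abs, sq_abs, Finset.sum_const, Finset.card_univ,
    Fintype.card_fin, nsmul_eq_mul]
  ring

theorem IsLocalMin.fderiv_fderiv_nonneg {E : Type*} [NormedAddCommGroup E] [NormedSpace ℝ E]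
    {ψ : E → ℝ} {x : E} (hψ : ContDiffAt ℝ 2 ψ x) (hmin : IsLocalMin ψ x) (v : E) :
    0 ≤ fderiv ℝ (fderiv ℝ ψ) x v v := by
  set l : ℝ → E := fun t => x + t • v with hl
  have hl0 : l 0 = x := by simp [hl]
  have hlc : ContinuousAt l 0 := by fun_prop
  have hld : ∀ t, HasDerivAt l v t := fun t => by
    have := ((hasDerivAt_id t).smul_const v).const_add x
    simp only [one_smul] at this
    exact this
  have hmin0 : IsLocalMin (ψ ∘ l) 0 := by
    have := hlc.tendsto
    rw [hl0] at this
    filter_upwards [this.eventually hmin] with t ht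
    simpa [hl0] using ht
  have hev : ∀ᶠ t in 𝓝 (0 : ℝ), deriv (ψ ∘ l) t = fderiv ℝ ψ (l t) v := by
    have h := hψ.eventually (by simp)
    rw [← hl0] at h
    filter_upwards [hlc.eventually h] with t ht
    exact ((ht.differentiableAt two_ne_zero).hasFDerivAt.comp_hasDerivAt t (hld t)).deriv
  have hdd : deriv (deriv (ψ ∘ l)) 0 = fderiv ℝ (fderiv ℝ ψ) x v v := by
    rw [EventuallyEq.deriv_eq hev]
    have h : DifferentiableAt ℝ (fderiv ℝ ψ) (l 0) := by
      rw [hl0]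
      exact (hψ.fderiv_right (m := 1) (by norm_num)).differentiableAt one_ne_zero
    have := (h.hasFDerivAt.comp_hasDerivAt 0 (hld 0)).clm_apply (hasDerivAt_const 0 v)
    simpa [hl0] using this.deriv
  rw [← hdd]
  -- A negative second derivative would make `0` a local maximum as well, so `ψ ∘ l` would be
  -- constant near `0` and its second derivative zero.
  by_contra! hneg
  have hmax := isLocalMax_of_deriv_deriv_neg hneg hmin0.deriv_eq_zero
    ((hl0 ▸ hψ.continuousAt : ContinuousAt ψ (l 0)).comp hlc)
  have hconst : (ψ ∘ l) =ᶠ[𝓝 0] fun _ => (ψ ∘ l) 0 := by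
    filter_upwards [hmax, hmin0] with t h1 h2 using le_antisymm h1 h2
  have := (hconst.deriv).deriv_eq
  simp [this] at hneg

/-- At a local minimum of a difference, the Laplacians are ordered. -/
theorem IsLocalMin.laplacian_le {n : ℕ} {u φ : EuclideanSpace ℝ (Fin n) → ℝ}
    {x : EuclideanSpace ℝ (Fin n)} (hu : ContDiffAt ℝ 2 u x) (hφ : ContDiffAt ℝ 2 φ x)
    (hmin : IsLocalMin (fun y => u y - φ y) x) : (Δ φ) x ≤ (Δ u) x := by
  have h : 0 ≤ (Δ (u - φ)) x := by
    rw [laplacian_eq_sum_fderiv_fderiv]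
    exact Finset.sum_nonneg fun i _ =>
      IsLocalMin.fderiv_fderiv_nonneg (hu.sub hφ) hmin _
  rw [hu.laplacian_sub hφ] at h
  linarith

/-- `-Δu(x) ≥ b` at the single point `x`, in the viscosity sense. -/
def ViscosityBoundAt {n : ℕ} (u : EuclideanSpace ℝ (Fin n) → ℝ) (x : EuclideanSpace ℝ (Fin n))
    (b : ℝ) : Prop :=
  ∀ φ : EuclideanSpace ℝ (Fin n) → ℝ, ContDiffAt ℝ 2 φ x →
    IsLocalMin (fun y => u y - φ y) x → b ≤ -(Δ φ) x

theorem ViscosityBoundAt.mono {n : ℕ} {u : EuclideanSpace ℝ (Fin n) → ℝ}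
    {x : EuclideanSpace ℝ (Fin n)} {b b' : ℝ} (h : ViscosityBoundAt u x b) (hb : b' ≤ b) :
    ViscosityBoundAt u x b' :=
  fun φ hφ hmin => hb.trans (h φ hφ hmin)

theorem ContDiffAt.viscosityBoundAt {n : ℕ} {u : EuclideanSpace ℝ (Fin n) → ℝ}
    {x : EuclideanSpace ℝ (Fin n)} (hu : ContDiffAt ℝ 2 u x) :
    ViscosityBoundAt u x (-(Δ u) x) :=
  fun _ hφ hmin => neg_le_neg (hmin.laplacian_le hu hφ)

/-! ### Comparison on annuli with quadratic polynomials in `log ‖x‖²` -/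

theorem contDiffAt_quadratic_log (α β γ : ℝ) {q : ℝ} (hq : 0 < q) :
    ContDiffAt ℝ 2 (fun q => α + β * Real.log q + γ * Real.log q ^ 2) q := by
  have : ContDiffAt ℝ 2 Real.log q := Real.contDiffAt_log.2 hq.ne'
  fun_prop

/-- Off the origin `s = log ‖x‖²` is harmonic in dimension two and `|∇s|² = 4 / ‖x‖²`, so only `γ
s²` contributes, through `2 γ |∇s|²`. -/
theorem laplacian_quadratic_log (α β γ : ℝ) {x : EuclideanSpace ℝ (Fin 2)} (hx : 0 < ‖x‖ ^ 2) :
    (Δ fun y : EuclideanSpace ℝ (Fin 2) =>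
      α + β * Real.log (‖y‖ ^ 2) + γ * Real.log (‖y‖ ^ 2) ^ 2) x = 8 * γ / ‖x‖ ^ 2 := by
  have h := laplacian_comp_norm_sub_sq (a := 0) (x := x)
    (h := fun q => α + β * Real.log q + γ * Real.log q ^ 2)
    (by simpa using contDiffAt_quadratic_log α β γ hx)
  simp only [sub_zero] at h
  rw [h]
  have hd : ∀ q : ℝ, 0 < q → HasDerivAt (fun q => α + β * Real.log q + γ * Real.log q ^ 2)
      ((β + 2 * γ * Real.log q) / q) q := by
    intro q hq
    have hl := Real.hasDerivAt_log hq.ne'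
    refine (((hl.const_mul β).const_add α).add ((hl.pow 2).const_mul γ)).congr_deriv ?_
    simp
    ring
  set q := ‖x‖ ^ 2
  have hdd : HasDerivAt (deriv fun q => α + β * Real.log q + γ * Real.log q ^ 2)
      ((2 * γ * q⁻¹ * q - (β + 2 * γ * Real.log q) * 1) / q ^ 2) q := by
    have hl := Real.hasDerivAt_log hx.ne'
    refine (((hl.const_mul (2 * γ)).const_add β).div (hasDerivAt_id q)
      hx.ne').congr_of_eventuallyEq ?_
    filter_upwards [lt_mem_nhds hx] with s hs using (hd s hs).deriv
  rw [hdd.deriv, (hd q hx).deriv]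
  field_simp
  push_cast
  ring

theorem isCompact_annulus {a b : ℝ} {n : ℕ} :
    IsCompact {x : EuclideanSpace ℝ (Fin n) | a ≤ ‖x‖ ^ 2 ∧ ‖x‖ ^ 2 ≤ b} := by
  refine (isCompact_closedBall (0 : EuclideanSpace ℝ (Fin n)) √b).of_isClosed_subset ?_ ?_
  · have hc : Continuous fun x : EuclideanSpace ℝ (Fin n) => ‖x‖ ^ 2 := by fun_prop
    exact (isClosed_le continuous_const hc).inter (isClosed_le hc continuous_const)
  · intro x hx
    simpa using Real.le_sqrt_of_sq_le hx.2

/-- At an interior minimum of `u` minus the polynomial, the polynomial is itself an admissible test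
function; this yields `4 k ≤ -8 γ`, against the strict inequality. Hence the minimum lies on the
boundary. -/
theorem quadratic_log_le_of_lt {u : EuclideanSpace ℝ (Fin 2) → ℝ} {k t₁ t₂ α β γ : ℝ}
    (hu : LowerSemicontinuousOn u {x | Real.exp t₁ ≤ ‖x‖ ^ 2 ∧ ‖x‖ ^ 2 ≤ Real.exp t₂})
    (hv : ∀ x, Real.exp t₁ < ‖x‖ ^ 2 → ‖x‖ ^ 2 < Real.exp t₂ →
      (∀ y, ‖y‖ = ‖x‖ → u x ≤ u y) → ViscosityBoundAt u x (4 * k / ‖x‖ ^ 2))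
    (hγ : -k < 2 * γ)
    (h₁ : ∀ x, ‖x‖ ^ 2 = Real.exp t₁ → α + β * t₁ + γ * t₁ ^ 2 ≤ u x)
    (h₂ : ∀ x, ‖x‖ ^ 2 = Real.exp t₂ → α + β * t₂ + γ * t₂ ^ 2 ≤ u x)
    {x : EuclideanSpace ℝ (Fin 2)} (hx₁ : Real.exp t₁ ≤ ‖x‖ ^ 2) (hx₂ : ‖x‖ ^ 2 ≤ Real.exp t₂) :
    α + β * Real.log (‖x‖ ^ 2) + γ * Real.log (‖x‖ ^ 2) ^ 2 ≤ u x := by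
  set v : EuclideanSpace ℝ (Fin 2) → ℝ := fun y =>
    α + β * Real.log (‖y‖ ^ 2) + γ * Real.log (‖y‖ ^ 2) ^ 2 with hvdef
  have hvc : ∀ y, 0 < ‖y‖ ^ 2 → ContDiffAt ℝ 2 v y := fun y hy =>
    ContDiffAt.comp y (contDiffAt_quadratic_log α β γ hy) (contDiff_id.norm_sq ℝ).contDiffAt
  have hlsc : LowerSemicontinuousOn (fun y => u y + -v y)
      {x | Real.exp t₁ ≤ ‖x‖ ^ 2 ∧ ‖x‖ ^ 2 ≤ Real.exp t₂} := by
    refine hu.add (ContinuousOn.lowerSemicontinuousOn fun y hy => ?_)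
    exact (hvc y ((Real.exp_pos _).trans_le hy.1)).continuousAt.neg.continuousWithinAt
  have hne : {x : EuclideanSpace ℝ (Fin 2) |
      Real.exp t₁ ≤ ‖x‖ ^ 2 ∧ ‖x‖ ^ 2 ≤ Real.exp t₂}.Nonempty := ⟨x, hx₁, hx₂⟩
  obtain ⟨z, hz, hmin⟩ := hlsc.exists_isMinOn hne isCompact_annulus
  have hmin' : ∀ y, Real.exp t₁ ≤ ‖y‖ ^ 2 → ‖y‖ ^ 2 ≤ Real.exp t₂ → u z + -v z ≤ u y + -v y :=
    fun y h h' => hmin ⟨h, h'⟩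
  suffices h : v z ≤ u z by
    have := hmin' x hx₁ hx₂
    change v x ≤ u x
    linarith
  rcases hz.1.eq_or_lt with hz₁ | hz₁
  · simpa only [hvdef, ← hz₁, Real.log_exp] using h₁ z hz₁.symm
  rcases hz.2.eq_or_lt with hz₂ | hz₂
  · simpa only [hvdef, hz₂, Real.log_exp] using h₂ z hz₂
  exfalso
  have hz0 : 0 < ‖z‖ ^ 2 := (Real.exp_pos _).trans hz₁
  have hcirc : ∀ y, ‖y‖ = ‖z‖ → u z ≤ u y := fun y hy => by
    have := hmin' y (by rw [hy]; exact hz.1) (by rw [hy]; exact hz.2)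
    have : v y = v z := by simp only [hvdef, hy]
    linarith
  have hloc : IsLocalMin (fun y => u y - v y) z := by
    have hc : ContinuousAt (fun y : EuclideanSpace ℝ (Fin 2) => ‖y‖ ^ 2) z := by fun_prop
    filter_upwards [hc.eventually (lt_mem_nhds hz₁), hc.eventually (gt_mem_nhds hz₂)] with y h h'
    have := hmin' y h.le h'.le
    linarith
  have := hv z hz₁ hz₂ hcirc v (hvc z hz0) hloc
  rw [laplacian_quadratic_log α β γ hz0, ← neg_div, div_le_div_iff_of_pos_right hz0] at this
  linarith

/-- Comparison on an annulus of a viscosity supersolution with a quadratic polynomial in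
`log ‖x‖²`. Only the points minimising `u` on their circle matter, because the polynomial is
radial. -/
theorem quadratic_log_le {u : EuclideanSpace ℝ (Fin 2) → ℝ} {k t₁ t₂ α β γ : ℝ}
    (hu : LowerSemicontinuousOn u {x | Real.exp t₁ ≤ ‖x‖ ^ 2 ∧ ‖x‖ ^ 2 ≤ Real.exp t₂})
    (hv : ∀ x, Real.exp t₁ < ‖x‖ ^ 2 → ‖x‖ ^ 2 < Real.exp t₂ →
      (∀ y, ‖y‖ = ‖x‖ → u x ≤ u y) → ViscosityBoundAt u x (4 * k / ‖x‖ ^ 2))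
    (hγ : -k ≤ 2 * γ)
    (h₁ : ∀ x, ‖x‖ ^ 2 = Real.exp t₁ → α + β * t₁ + γ * t₁ ^ 2 ≤ u x)
    (h₂ : ∀ x, ‖x‖ ^ 2 = Real.exp t₂ → α + β * t₂ + γ * t₂ ^ 2 ≤ u x)
    {x : EuclideanSpace ℝ (Fin 2)} (hx₁ : Real.exp t₁ ≤ ‖x‖ ^ 2) (hx₂ : ‖x‖ ^ 2 ≤ Real.exp t₂) :
    α + β * Real.log (‖x‖ ^ 2) + γ * Real.log (‖x‖ ^ 2) ^ 2 ≤ u x := by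
  -- Adding `δ (s - t₁) (s - t₂)` leaves the boundary values unchanged and makes the inequality on
  -- `γ` strict; then `δ → 0`.
  have hlim : Tendsto (fun δ : ℝ => α + δ * t₁ * t₂ + (β - δ * (t₁ + t₂)) * Real.log (‖x‖ ^ 2) +
      (γ + δ) * Real.log (‖x‖ ^ 2) ^ 2) (𝓝[>] 0)
      (𝓝 (α + β * Real.log (‖x‖ ^ 2) + γ * Real.log (‖x‖ ^ 2) ^ 2)) := by
    have : Continuous (fun δ : ℝ => α + δ * t₁ * t₂ +
        (β - δ * (t₁ + t₂)) * Real.log (‖x‖ ^ 2) + (γ + δ) * Real.log (‖x‖ ^ 2) ^ 2) := by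
      fun_prop
    have := (this.tendsto 0).mono_left (nhdsWithin_le_nhds (s := Set.Ioi 0))
    simpa using this
  refine le_of_tendsto hlim ?_
  filter_upwards [self_mem_nhdsWithin] with δ (hδ : 0 < δ)
  refine quadratic_log_le_of_lt hu hv (by linarith) (fun y hy => ?_) (fun y hy => ?_) hx₁ hx₂
  · have := h₁ y hy
    nlinarith
  · have := h₂ y hy
    nlinarith

/-! ### Positive superharmonic functions near infinity -/

theorem exists_circle_isMin {u : EuclideanSpace ℝ (Fin 2) → ℝ} {t : ℝ}
    (hu : LowerSemicontinuousOn u {x | Real.exp t ≤ ‖x‖ ^ 2}) :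
    ∃ x, ‖x‖ ^ 2 = Real.exp t ∧ ∀ y, ‖y‖ ^ 2 = Real.exp t → u x ≤ u y := by
  have hne : {x : EuclideanSpace ℝ (Fin 2) |
      Real.exp t ≤ ‖x‖ ^ 2 ∧ ‖x‖ ^ 2 ≤ Real.exp t}.Nonempty := by
    refine ⟨EuclideanSpace.single 0 (Real.exp (t / 2)), ?_⟩
    have : Real.exp (t / 2) ^ 2 = Real.exp t := by
      rw [← Real.exp_nat_mul]
      congr 1
      push_cast
      ring
    simp [abs_of_pos (Real.exp_pos _), this]
  obtain ⟨z, hz, hmin⟩ := (hu.mono fun x hx => hx.1).exists_isMinOn hne isCompact_annulus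
  exact ⟨z, le_antisymm hz.2 hz.1, fun y hy => hmin ⟨hy.ge, hy.le⟩⟩

/-- Positive superharmonic functions near infinity in the plane are bounded below by their
minimum on a circle. -/
theorem exists_pos_le_of_superharmonic {u : EuclideanSpace ℝ (Fin 2) → ℝ} {t : ℝ}
    (hu : LowerSemicontinuousOn u {x | Real.exp t ≤ ‖x‖ ^ 2})
    (hpos : ∀ x, Real.exp t ≤ ‖x‖ ^ 2 → 0 < u x)
    (hv : ∀ x, Real.exp t < ‖x‖ ^ 2 → ViscosityBoundAt u x 0) :
    ∃ c, 0 < c ∧ ∀ x, Real.exp t ≤ ‖x‖ ^ 2 → c ≤ u x := by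
  obtain ⟨z, hz, hmin⟩ := exists_circle_isMin hu
  refine ⟨u z, hpos z hz.ge, fun x hx => ?_⟩
  have hlim : Tendsto (fun s => u z - u z * (Real.log (‖x‖ ^ 2) - t) * (s - t)⁻¹) atTop
      (𝓝 (u z - u z * (Real.log (‖x‖ ^ 2) - t) * 0)) := by
    refine (Tendsto.const_mul _ ?_).const_sub _
    exact tendsto_inv_atTop_zero.comp (tendsto_atTop_add_const_right _ (-t) tendsto_id)
  rw [mul_zero, sub_zero] at hlim
  refine le_of_tendsto hlim ?_
  filter_upwards [eventually_gt_atTop t, eventually_ge_atTop (Real.log (‖x‖ ^ 2))] with s hs hs'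
  have hx0 : 0 < ‖x‖ ^ 2 := (Real.exp_pos _).trans_le hx
  have hst : s - t ≠ 0 := (sub_pos.2 hs).ne'
  -- The barrier is affine in `log ‖x‖²`, equal to `u z` on the inner circle and to `0` on the outer
  -- one; it tends to `u z` as `s → ∞`.
  have h := quadratic_log_le (k := 0) (t₁ := t) (t₂ := s)
    (α := u z + u z * t * (s - t)⁻¹) (β := -(u z * (s - t)⁻¹)) (γ := 0) (x := x)
    (hu.mono fun y hy => hy.1) (fun y hy _ _ => by simpa using hv y hy) (by simp)
    (fun y hy => by
      have := hmin y hy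
      ring_nf
      linarith)
    (fun y hy => by
      have h0 : u z + u z * t * (s - t)⁻¹ + -(u z * (s - t)⁻¹) * s + 0 * s ^ 2 = 0 := by
        field_simp
        ring
      rw [h0]
      exact (hpos y (by rw [hy]; exact Real.exp_le_exp.2 hs.le)).le)
    hx ((Real.log_le_iff_le_exp hx0).1 hs')
  refine le_trans (le_of_eq ?_) h
  ring

/-- There is no positive viscosity solution near infinity in the plane of the inequalities
`-Δu ≥ c exp(-a u)`, where `c > 0` may depend on `a > 0`. -/
theorem false_of_exp_bound {u : EuclideanSpace ℝ (Fin 2) → ℝ} {t : ℝ}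
    (hu : LowerSemicontinuousOn u {x | Real.exp t ≤ ‖x‖ ^ 2})
    (hpos : ∀ x, Real.exp t ≤ ‖x‖ ^ 2 → 0 < u x)
    (hv : ∀ a : ℝ, 0 < a → ∃ c : ℝ, 0 < c ∧ ∀ x, Real.exp t < ‖x‖ ^ 2 →
      ViscosityBoundAt u x (c * Real.exp (-a * u x))) : False := by
  have hv0 : ∀ x, Real.exp t < ‖x‖ ^ 2 → ViscosityBoundAt u x 0 := fun x hx => by
    obtain ⟨c, hc, h⟩ := hv 1 one_pos
    exact (h x hx).mono (by positivity)
  obtain ⟨z, hz, -⟩ := exists_circle_isMin (t := t + 1)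
    (hu.mono fun y hy => (Real.exp_le_exp.2 (by linarith)).trans hy)
  have hlogz : Real.log (‖z‖ ^ 2) = t + 1 := by rw [hz, Real.log_exp]
  have hM : 0 < u z := hpos z (by rw [hz]; exact Real.exp_le_exp.2 (by linarith))
  set M := u z
  -- minima over circles grow at most linearly in `log ‖x‖²`
  have hgrow : ∀ x, Real.exp (t + 1) ≤ ‖x‖ ^ 2 → (∀ y, ‖y‖ = ‖x‖ → u x ≤ u y) →
      u x ≤ M * (Real.log (‖x‖ ^ 2) - t) := by
    intro x hx hmin
    have hx0 : 0 < ‖x‖ ^ 2 := (Real.exp_pos _).trans_le hx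
    have hs : t + 1 ≤ Real.log (‖x‖ ^ 2) := (Real.le_log_iff_exp_le hx0).2 hx
    set s := Real.log (‖x‖ ^ 2) with hsdef
    have hes : Real.exp s = ‖x‖ ^ 2 := Real.exp_log hx0
    have hst : s - t ≠ 0 := by linarith
    -- The affine barrier is `0` on the inner circle and `u x` on the circle of `x`. At `z`, one
    -- unit of `log ‖·‖²` away from the inner circle, it equals its slope.
    have h := quadratic_log_le (k := 0) (t₁ := t) (t₂ := s)
      (α := -(u x * t * (s - t)⁻¹)) (β := u x * (s - t)⁻¹) (γ := 0) (x := z)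
      (hu.mono fun y hy => hy.1) (fun y hy _ _ => by simpa using hv0 y hy) (by simp)
      (fun y hy => by
        have := hpos y hy.ge
        ring_nf
        exact this.le)
      (fun y hy => by
        have h0 : -(u x * t * (s - t)⁻¹) + u x * (s - t)⁻¹ * s + 0 * s ^ 2 = u x := by
          field_simp
          ring
        rw [h0]
        refine hmin y ?_
        rw [hes] at hy
        exact (sq_eq_sq₀ (norm_nonneg _) (norm_nonneg _)).1 hy)
      (by rw [hz]; exact Real.exp_le_exp.2 (by linarith)) (by rw [hz]; exact Real.exp_le_exp.2 hs)
    rw [hlogz] at h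
    have h' : u x * (s - t)⁻¹ ≤ M := by
      refine le_trans (le_of_eq ?_) h
      ring
    rwa [← div_eq_mul_inv, div_le_iff₀ (by linarith)] at h'
  -- The exponent `1 / M` cancels the slope in `hgrow`: at circle minima `exp(-u / M) ≥ exp t /
  -- ‖x‖²`.
  obtain ⟨c, hc, hvc⟩ := hv M⁻¹ (by positivity)
  set k := c * Real.exp t / 4 with hk
  have hk0 : 0 < k := by positivity
  obtain ⟨w, hw, -⟩ := exists_circle_isMin (t := t + 2)
    (hu.mono fun y hy => (Real.exp_le_exp.2 (by linarith)).trans hy)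
  have hlogw : Real.log (‖w‖ ^ 2) = t + 2 := by rw [hw, Real.log_exp]
  have hbound : ∀ s, t + 2 < s → k / 2 * (s - (t + 2)) ≤ u w := by
    intro s hs
    -- The barrier is `k / 2 * (τ - (t + 1)) * (s - τ)` with `τ = log ‖x‖²`, evaluated at `τ = t +
    -- 2`.
    have h := quadratic_log_le (k := k) (t₁ := t + 1) (t₂ := s) (α := -(k / 2 * (t + 1) * s))
      (β := k / 2 * (t + 1 + s)) (γ := -(k / 2)) (x := w) (u := u)
      (hu.mono fun y hy => (Real.exp_le_exp.2 (by linarith)).trans hy.1)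
      (fun y hy _ hmin => by
        have hy0 : 0 < ‖y‖ ^ 2 := (Real.exp_pos _).trans hy
        refine (hvc y ((Real.exp_lt_exp.2 (by linarith)).trans hy)).mono ?_
        have h1 : M⁻¹ * u y ≤ Real.log (‖y‖ ^ 2) - t :=
          (inv_mul_le_iff₀ hM).2 (hgrow y hy.le hmin)
        have h2 : Real.exp t / ‖y‖ ^ 2 ≤ Real.exp (-M⁻¹ * u y) := by
          nth_rw 1 [← Real.exp_log hy0]
          rw [← Real.exp_sub]
          exact Real.exp_le_exp.2 (by linarith)
        calc 4 * k / ‖y‖ ^ 2 = c * (Real.exp t / ‖y‖ ^ 2) := by rw [hk]; ring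
          _ ≤ _ := by gcongr)
      (by linarith)
      (fun y hy => by
        have := hpos y (by rw [hy]; exact Real.exp_le_exp.2 (by linarith))
        ring_nf
        exact this.le)
      (fun y hy => by
        have := hpos y (by rw [hy]; exact Real.exp_le_exp.2 (by linarith))
        ring_nf
        exact this.le)
      (by rw [hw]; exact Real.exp_le_exp.2 (by linarith))
      (by rw [hw]; exact Real.exp_le_exp.2 hs.le)
    rw [hlogw] at h
    refine le_trans (le_of_eq ?_) h
    ring
  have huw : 0 < u w := hpos w (by rw [hw]; exact Real.exp_le_exp.2 (by linarith))
  -- This outer radius turns the bound into `2 * u w ≤ u w`.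
  have h := hbound (t + 2 + 4 * u w / k) (by have : 0 < 4 * u w / k := by positivity
                                             linarith)
  have h2 : k / 2 * (t + 2 + 4 * u w / k - (t + 2)) = 2 * u w := by
    field_simp
    ring
  linarith

/-! ### Exponential minorants of `f`; classical and viscosity supersolutions -/

/-- For large `s` the limit hypothesis suffices, and on the remaining compact interval `exp(a s)
f(s)` has a positive minimum. The cut at `b > 0` is essential, since `f` may tend to `0` at `0`. -/
theorem exists_exp_le {f : ℝ → ℝ} (hf_cont : ContinuousOn f (Set.Ioi 0))
    (hf_pos : ∀ s, 0 < s → 0 < f s)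
    (hf_lim : ∀ a : ℝ, 0 < a → Tendsto (fun s => Real.exp (a * s) * f s) atTop atTop)
    {a b : ℝ} (ha : 0 < a) (hb : 0 < b) :
    ∃ c : ℝ, 0 < c ∧ ∀ s, b ≤ s → c * Real.exp (-a * s) ≤ f s := by
  obtain ⟨s₀, hs₀⟩ := eventually_atTop.1 ((hf_lim a ha).eventually_ge_atTop 1)
  have hcont : ContinuousOn (fun s => Real.exp (a * s) * f s) (Set.Icc b (max b s₀)) :=
    (Continuous.continuousOn (by fun_prop)).mul
      (hf_cont.mono fun s hs => hb.trans_le hs.1)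
  obtain ⟨z, hz, hmin⟩ := isCompact_Icc.exists_isMinOn
    (Set.nonempty_Icc.2 (le_max_left b s₀)) hcont
  have hz0 : 0 < Real.exp (a * z) * f z :=
    mul_pos (Real.exp_pos _) (hf_pos z (hb.trans_le hz.1))
  refine ⟨min 1 (Real.exp (a * z) * f z), lt_min one_pos hz0, fun s hs => ?_⟩
  have h : min 1 (Real.exp (a * z) * f z) ≤ Real.exp (a * s) * f s := by
    rcases le_total s₀ s with h | h
    · exact (min_le_left _ _).trans (hs₀ s h)
    · exact (min_le_right _ _).trans (hmin ⟨hs, h.trans (le_max_right _ _)⟩)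
  calc _ ≤ (Real.exp (a * s) * f s) * Real.exp (-a * s) := by gcongr
    _ = f s := by
      rw [mul_right_comm, ← Real.exp_add]
      simp

theorem IsExteriorDomain.exists_radius {n : ℕ} {Ω : Set (EuclideanSpace ℝ (Fin n))}
    (hΩ : IsExteriorDomain Ω) : ∃ R : ℝ, 0 < R ∧ ∀ x, R ≤ ‖x‖ → x ∈ Ω := by
  obtain ⟨R, hR⟩ := hΩ.2.2.isBounded.subset_closedBall 0
  refine ⟨max R 0 + 1, by positivity, fun x hx => ?_⟩
  by_contra h
  have h1 := hR h
  simp only [Metric.mem_closedBall, dist_zero_right] at h1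
  linarith [le_max_left R 0]

/-- The test functions in the definition of a viscosity supersolution may be taken to be of
class `C²` only near the point of contact. -/
theorem IsViscositySupersolution.viscosityBoundAt {n : ℕ} {f : ℝ → ℝ}
    {Ω : Set (EuclideanSpace ℝ (Fin n))} {u : EuclideanSpace ℝ (Fin n) → ℝ}
    (hu : IsViscositySupersolution f Ω u) {x : EuclideanSpace ℝ (Fin n)} (hx : x ∈ Ω) :
    ViscosityBoundAt u x (f (u x)) := by
  intro φ hφ hmin
  obtain ⟨r, hr, hball⟩ := Metric.eventually_nhds_iff_ball.1 (hφ.eventually (by simp))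
  -- The cutoff is `1` near `x` and supported inside the ball where `φ` is `C²`, so the product is
  -- globally `C²`.
  let χ : ContDiffBump x := ⟨r / 4, r / 2, by positivity, by linarith⟩
  have heq : (fun y => χ y * φ y) =ᶠ[𝓝 x] φ := by
    filter_upwards [χ.eventuallyEq_one] with y hy
    simp [hy]
  have hsmooth : ContDiff ℝ 2 (fun y => χ y * φ y) := by
    rw [contDiff_iff_contDiffAt]
    intro y
    by_cases hy : y ∈ Metric.ball x r
    · exact χ.contDiffAt.mul (hball y hy)
    · have hy' : y ∉ tsupport χ := by
        rw [χ.tsupport_eq]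
        simp only [Metric.mem_closedBall, Metric.mem_ball, not_lt, not_le] at hy ⊢
        change r / 2 < dist y x
        linarith
      refine contDiffAt_const (c := 0) |>.congr_of_eventuallyEq ?_
      filter_upwards [notMem_tsupport_iff_eventuallyEq.1 hy'] with z hz
      simp [hz]
  have h := hu.2 x hx _ hsmooth.contDiffOn (hmin.congr (by
    filter_upwards [heq] with y hy
    rw [hy]))
  rwa [(InnerProductSpace.laplacian_congr_nhds heq).eq_of_nhds] at h

section

variable {f : ℝ → ℝ} {Ω : Set (EuclideanSpace ℝ (Fin 2))} {u : EuclideanSpace ℝ (Fin 2) → ℝ}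

theorem false_of_viscosityBoundAt (hf_cont : ContinuousOn f (Set.Ioi 0))
    (hf_pos : ∀ s, 0 < s → 0 < f s)
    (hf_lim : ∀ a : ℝ, 0 < a → Tendsto (fun s => Real.exp (a * s) * f s) atTop atTop)
    (hΩ : IsExteriorDomain Ω) (hpos : ∀ x ∈ Ω, 0 < u x) (hu : LowerSemicontinuousOn u Ω)
    (hv : ∀ x ∈ Ω, ViscosityBoundAt u x (f (u x))) : False := by
  obtain ⟨R, hR, hRΩ⟩ := hΩ.exists_radius
  set t := Real.log (R ^ 2)
  have hsub : ∀ x : EuclideanSpace ℝ (Fin 2), Real.exp t ≤ ‖x‖ ^ 2 → x ∈ Ω := fun x hx => by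
    rw [Real.exp_log (by positivity)] at hx
    exact hRΩ x ((sq_le_sq₀ hR.le (norm_nonneg _)).1 hx)
  obtain ⟨b, hb, hbu⟩ := exists_pos_le_of_superharmonic (u := u) (t := t) (hu.mono hsub)
    (fun x hx => hpos x (hsub x hx))
    fun x hx => (hv x (hsub x hx.le)).mono (hf_pos _ (hpos x (hsub x hx.le))).le
  refine false_of_exp_bound (u := u) (t := t) (hu.mono hsub) (fun x hx => hpos x (hsub x hx))
    fun a ha => ?_
  obtain ⟨c, hc, hcf⟩ := exists_exp_le hf_cont hf_pos hf_lim ha hb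
  exact ⟨c, hc, fun x hx => (hv x (hsub x hx.le)).mono (hcf _ (hbu x hx.le))⟩

theorem IsClassicalSupersolution.not_pos (hf_cont : ContinuousOn f (Set.Ioi 0))
    (hf_pos : ∀ s, 0 < s → 0 < f s)
    (hf_lim : ∀ a : ℝ, 0 < a → Tendsto (fun s => Real.exp (a * s) * f s) atTop atTop)
    (hΩ : IsExteriorDomain Ω) (hu : IsClassicalSupersolution f Ω u) : ¬ ∀ x ∈ Ω, 0 < u x :=
  fun hpos => false_of_viscosityBoundAt hf_cont hf_pos hf_lim hΩ hpos
    hu.1.continuousOn.lowerSemicontinuousOn fun x hx =>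
      ((hu.1.contDiffAt (hΩ.1.mem_nhds hx)).viscosityBoundAt).mono (hu.2 x hx)

theorem IsViscositySupersolution.not_pos (hf_cont : ContinuousOn f (Set.Ioi 0))
    (hf_pos : ∀ s, 0 < s → 0 < f s)
    (hf_lim : ∀ a : ℝ, 0 < a → Tendsto (fun s => Real.exp (a * s) * f s) atTop atTop)
    (hΩ : IsExteriorDomain Ω) (hu : IsViscositySupersolution f Ω u) : ¬ ∀ x ∈ Ω, 0 < u x :=
  fun hpos => false_of_viscosityBoundAt hf_cont hf_pos hf_lim hΩ hpos hu.1
    fun _ hx => hu.viscosityBoundAt hx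

end

/-! ### Radial mollifiers in the plane -/

theorem two_le_infty : (2 : WithTop ℕ∞) ≤ ∞ := WithTop.coe_le_coe.2 le_top

/-- A smooth antiderivative of `expNegInvGlue / 2`. -/
noncomputable def glueIntegral (r : ℝ) : ℝ := ∫ σ in (0 : ℝ)..r, expNegInvGlue σ / 2

theorem hasDerivAt_glueIntegral (r : ℝ) :
    HasDerivAt glueIntegral (expNegInvGlue r / 2) r := by
  have hc : Continuous fun σ => expNegInvGlue σ / 2 :=
    (expNegInvGlue.contDiff (n := 0)).continuous.div_const 2
  exact intervalIntegral.integral_hasDerivAt_right (hc.intervalIntegrable _ _)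
    hc.stronglyMeasurable.stronglyMeasurableAtFilter hc.continuousAt

theorem contDiff_glueIntegral : ContDiff ℝ ∞ glueIntegral := by
  rw [contDiff_infty_iff_deriv]
  refine ⟨fun r => (hasDerivAt_glueIntegral r).differentiableAt, ?_⟩
  rw [funext fun r => (hasDerivAt_glueIntegral r).deriv]
  exact (expNegInvGlue.contDiff (n := ⊤)).div_const 2

theorem glueIntegral_of_nonpos {r : ℝ} (hr : r ≤ 0) : glueIntegral r = 0 := by
  rw [glueIntegral, intervalIntegral.integral_congr (g := fun _ => 0)]
  · simp
  · intro σ hσ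
    rw [Set.uIcc_of_ge hr] at hσ
    simp [expNegInvGlue.zero_of_nonpos hσ.2]

theorem glueIntegral_nonneg (r : ℝ) : 0 ≤ glueIntegral r := by
  rcases le_total r 0 with hr | hr
  · rw [glueIntegral_of_nonpos hr]
  · exact intervalIntegral.integral_nonneg hr fun σ _ => by
      have := expNegInvGlue.nonneg σ
      positivity

theorem expNegInvGlue_le_one (r : ℝ) : expNegInvGlue r ≤ 1 := by
  rcases le_or_gt r 0 with hr | hr
  · rw [expNegInvGlue.zero_of_nonpos hr]
    exact zero_le_one
  · rw [expNegInvGlue, if_neg hr.not_ge]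
    exact Real.exp_le_one_iff.2 (by have := inv_pos.2 hr; linarith)

/-- The mass of the bump `y ↦ expNegInvGlue (1 - ‖y‖²)`. -/
noncomputable def bumpMass : ℝ :=
  ∫ y : EuclideanSpace ℝ (Fin 2), expNegInvGlue (1 - ‖y‖ ^ 2)

/-- The radial mollifier of radius `t`, as a function of the squared radius. -/
noncomputable def mollProfile (t q : ℝ) : ℝ :=
  bumpMass⁻¹ * (t ^ 2)⁻¹ * expNegInvGlue (1 - q / t ^ 2)

/-- The radial mollifier of radius `t` in the plane. -/
noncomputable def moll (t : ℝ) (y : EuclideanSpace ℝ (Fin 2)) : ℝ := mollProfile t (‖y‖ ^ 2)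

theorem one_sub_div_sq_nonpos {t r : ℝ} (ht : 0 < t) (h : t ≤ r) : 1 - r ^ 2 / t ^ 2 ≤ 0 := by
  rw [sub_nonpos, one_le_div₀ (by positivity)]
  gcongr

theorem hasCompactSupport_bump {t : ℝ} (ht : 0 < t) {g : ℝ → ℝ} (hg : ∀ r ≤ 0, g r = 0)
    {n : ℕ} (x : EuclideanSpace ℝ (Fin n)) :
    HasCompactSupport (fun y => g (1 - ‖y - x‖ ^ 2 / t ^ 2)) ∧
      tsupport (fun y => g (1 - ‖y - x‖ ^ 2 / t ^ 2)) ⊆ Metric.closedBall x t := by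
  have h : ∀ y, y ∉ Metric.closedBall x t → g (1 - ‖y - x‖ ^ 2 / t ^ 2) = 0 := by
    intro y hy
    rw [Metric.mem_closedBall, dist_eq_norm, not_le] at hy
    exact hg _ (one_sub_div_sq_nonpos ht hy.le)
  refine ⟨HasCompactSupport.intro (isCompact_closedBall x t) h, ?_⟩
  refine closure_minimal (fun y hy => ?_) Metric.isClosed_closedBall
  by_contra h'
  exact hy (h y h')

theorem bumpMass_pos : 0 < bumpMass := by
  have hc : Continuous fun y : EuclideanSpace ℝ (Fin 2) => expNegInvGlue (1 - ‖y‖ ^ 2) :=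
    (expNegInvGlue.contDiff (n := 0)).continuous.comp (by fun_prop)
  have hs := (hasCompactSupport_bump one_pos (fun r hr => expNegInvGlue.zero_of_nonpos hr)
    (0 : EuclideanSpace ℝ (Fin 2))).1
  simp only [sub_zero, one_pow, div_one] at hs
  refine hc.integral_pos_of_hasCompactSupport_nonneg_nonzero hs
    (fun y => expNegInvGlue.nonneg _) (x := 0) ?_
  simp

theorem moll_nonneg (t : ℝ) (y : EuclideanSpace ℝ (Fin 2)) : 0 ≤ moll t y := by
  have := bumpMass_pos
  have := expNegInvGlue.nonneg (1 - ‖y‖ ^ 2 / t ^ 2)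
  unfold moll mollProfile
  positivity

theorem moll_pos {t : ℝ} {y : EuclideanSpace ℝ (Fin 2)} (hy : ‖y‖ < t) : 0 < moll t y := by
  have ht : 0 < t := (norm_nonneg y).trans_lt hy
  have := bumpMass_pos
  have : 0 < expNegInvGlue (1 - ‖y‖ ^ 2 / t ^ 2) := by
    refine expNegInvGlue.pos_of_pos ?_
    rw [sub_pos, div_lt_one (by positivity)]
    gcongr
  unfold moll mollProfile
  positivity

theorem moll_le (t : ℝ) (y : EuclideanSpace ℝ (Fin 2)) :
    moll t y ≤ bumpMass⁻¹ * (t ^ 2)⁻¹ := by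
  have := bumpMass_pos
  unfold moll mollProfile
  exact mul_le_of_le_one_right (by positivity) (expNegInvGlue_le_one _)

theorem moll_eq_zero {t : ℝ} (ht : 0 < t) {y : EuclideanSpace ℝ (Fin 2)} (hy : t ≤ ‖y‖) :
    moll t y = 0 := by
  simp [moll, mollProfile, expNegInvGlue.zero_of_nonpos (one_sub_div_sq_nonpos ht hy)]

theorem contDiff_mollProfile (t : ℝ) : ContDiff ℝ ∞ (mollProfile t) :=
  contDiff_const.mul ((expNegInvGlue.contDiff (n := ⊤)).comp
    (contDiff_const.sub (contDiff_id.div_const _)))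

theorem contDiff_moll (t : ℝ) : ContDiff ℝ ∞ (moll t) :=
  (contDiff_mollProfile t).comp (contDiff_id.norm_sq ℝ)

theorem hasCompactSupport_moll {t : ℝ} (ht : 0 < t) : HasCompactSupport (moll t) :=
  HasCompactSupport.intro (isCompact_closedBall 0 t) fun y hy => by
    rw [Metric.mem_closedBall, dist_zero_right, not_le] at hy
    exact moll_eq_zero ht hy.le

/-- Joint regularity in scale and position is what permits differentiating a mollification in its
scale. -/
theorem contDiffOn_moll_uncurry : ContDiffOn ℝ 1 (↿moll) (Set.Ioi 0 ×ˢ Set.univ) := by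
  have h : ContDiffOn ℝ 1 (fun p : ℝ × EuclideanSpace ℝ (Fin 2) => (p.1 ^ 2)⁻¹)
      (Set.Ioi 0 ×ˢ Set.univ) :=
    (contDiff_fst.pow 2).contDiffOn.inv fun p hp => (pow_pos hp.1 2).ne'
  change ContDiffOn ℝ 1 (fun p : ℝ × EuclideanSpace ℝ (Fin 2) =>
    bumpMass⁻¹ * (p.1 ^ 2)⁻¹ * expNegInvGlue (1 - ‖p.2‖ ^ 2 / p.1 ^ 2)) _
  refine (contDiffOn_const.mul h).mul ((expNegInvGlue.contDiff (n := 1)).comp_contDiffOn ?_)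
  simp only [div_eq_mul_inv]
  exact contDiffOn_const.sub ((contDiff_snd.norm_sq ℝ).contDiffOn.mul h)

theorem integral_moll {t : ℝ} (ht : 0 < t) : ∫ y, moll t y = 1 := by
  have h : ∀ y : EuclideanSpace ℝ (Fin 2), moll t y =
      bumpMass⁻¹ * (t ^ 2)⁻¹ * expNegInvGlue (1 - ‖t⁻¹ • y‖ ^ 2) := by
    intro y
    have : ‖t⁻¹ • y‖ ^ 2 = ‖y‖ ^ 2 / t ^ 2 := by
      rw [norm_smul, mul_pow, Real.norm_eq_abs, sq_abs, inv_pow, inv_mul_eq_div]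
    rw [this]
    rfl
  simp only [h]
  rw [integral_const_mul, Measure.integral_comp_inv_smul volume
    (fun y : EuclideanSpace ℝ (Fin 2) => expNegInvGlue (1 - ‖y‖ ^ 2)) t]
  simp only [finrank_euclideanSpace, Fintype.card_fin, abs_pow, sq_abs, smul_eq_mul]
  change bumpMass⁻¹ * (t ^ 2)⁻¹ * (t ^ 2 * bumpMass) = 1
  have := bumpMass_pos
  field_simp

/-- Since the mollifier is even, its Laplacian as a test function in `z` agrees with the one
produced by the convolution in `x`. -/
theorem laplacian_mollProfile (t : ℝ) (x z : EuclideanSpace ℝ (Fin 2)) :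
    (Δ fun y => mollProfile t (‖y - x‖ ^ 2)) z = (Δ (moll t)) (x - z) := by
  have h1 := laplacian_comp_norm_sub_sq (a := x) (x := z)
    ((contDiff_mollProfile t).of_le two_le_infty).contDiffAt
  have h2 := laplacian_comp_norm_sub_sq (a := 0) (x := x - z)
    ((contDiff_mollProfile t).of_le two_le_infty).contDiffAt
  simp only [sub_zero] at h2
  change (Δ (moll t)) (x - z) = _ at h2
  rw [h1, h2, norm_sub_rev]

/-- The derivative of the mollifier in its radius is, up to a positive factor, the Laplacian of a
nonnegative bump. -/
theorem hasDerivAt_moll {t : ℝ} (ht : 0 < t) (x z : EuclideanSpace ℝ (Fin 2)) :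
    HasDerivAt (fun s => moll s (x - z))
      (bumpMass⁻¹ * t⁻¹ * (Δ fun y => glueIntegral (1 - ‖y - x‖ ^ 2 / t ^ 2)) z) t := by
  have hd : ∀ q : ℝ, HasDerivAt (fun q => 1 - q / t ^ 2) (-(1 / t ^ 2)) q := fun q =>
    ((hasDerivAt_id q).div_const _).const_sub 1
  have hk : ∀ q : ℝ, HasDerivAt (fun q => glueIntegral (1 - q / t ^ 2))
      (expNegInvGlue (1 - q / t ^ 2) / 2 * -(1 / t ^ 2)) q := fun q =>
    HasDerivAt.comp (h₂ := glueIntegral) q (hasDerivAt_glueIntegral _) (hd q)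
  have he : ∀ r, HasDerivAt expNegInvGlue (deriv expNegInvGlue r) r := fun r =>
    ((expNegInvGlue.contDiff (n := 1)).differentiable one_ne_zero r).hasDerivAt
  have hkk : ∀ q : ℝ, HasDerivAt (fun q => expNegInvGlue (1 - q / t ^ 2) / 2 * -(1 / t ^ 2))
      (deriv expNegInvGlue (1 - q / t ^ 2) * -(1 / t ^ 2) / 2 * -(1 / t ^ 2)) q := fun q =>
    (((he _).comp q (hd q)).div_const 2).mul_const _
  have hsm : ContDiff ℝ 2 (fun q => glueIntegral (1 - q / t ^ 2)) :=
    (contDiff_glueIntegral.of_le two_le_infty).comp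
      (contDiff_const.sub (contDiff_id.div_const _))
  -- With `η = expNegInvGlue` and `q = ‖z - x‖²`, the Laplacian is `2 q η' / t⁴ - 2 η / t²`, which
  -- is `t` times the derivative of `η(1 - q / t²) / t²` in `t`; the factor `1 / 2` in
  -- `glueIntegral` matches the constants.
  rw [laplacian_comp_norm_sub_sq (h := fun q => glueIntegral (1 - q / t ^ 2)) hsm.contDiffAt,
    funext fun q => (hk q).deriv, (hkk _).deriv]
  have hm := ((((hasDerivAt_pow 2 t).inv (by positivity)).const_mul bumpMass⁻¹).mul
    ((he (1 - ‖x - z‖ ^ 2 / t ^ 2)).comp t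
      (((hasDerivAt_const t (‖x - z‖ ^ 2)).div (hasDerivAt_pow 2 t) (by positivity)).const_sub 1)))
  refine HasDerivAt.congr_deriv (f := fun s => moll s (x - z)) hm ?_
  rw [norm_sub_rev z x]
  have := bumpMass_pos
  simp only [Function.comp, Pi.inv_apply, Pi.div_apply]
  field_simp
  push_cast
  ring

/-! ### Distributional form of the weak inequality and convolutions -/

section WeakForm

variable {n : ℕ} {Ω : Set (EuclideanSpace ℝ (Fin n))}

theorem MemL2Loc.integrableOn {F : Type*} [NormedAddCommGroup F]
    {g : EuclideanSpace ℝ (Fin n) → F} (hg : MemL2Loc Ω g) {K : Set (EuclideanSpace ℝ (Fin n))}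
    (hK : IsCompact K) (hKΩ : K ⊆ Ω) : IntegrableOn g K := by
  have : IsFiniteMeasure (volume.restrict K) := ⟨by simpa using hK.measure_lt_top⟩
  exact (hg K hK hKΩ).integrable one_le_two

theorem MemL2Loc.integrableOn_mul {g ψ : EuclideanSpace ℝ (Fin n) → ℝ} (hg : MemL2Loc Ω g)
    (hψ : Continuous ψ) (hc : HasCompactSupport ψ) (hs : tsupport ψ ⊆ Ω) :
    IntegrableOn (fun x => g x * ψ x) Ω := by
  have h : IntegrableOn (fun x => g x * ψ x) (tsupport ψ) :=
    (hg.integrableOn hc hs).mul_continuousOn hψ.continuousOn hc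
  have h' : Integrable (fun x => g x * ψ x) :=
    (integrableOn_iff_integrable_of_support_subset fun x hx =>
      subset_tsupport ψ (right_ne_zero_of_mul hx)).1 h
  exact h'.integrableOn

theorem IsTestFunction.fderiv_apply {φ : EuclideanSpace ℝ (Fin n) → ℝ} (hφ : IsTestFunction Ω φ)
    (v : EuclideanSpace ℝ (Fin n)) : IsTestFunction Ω (fun x => fderiv ℝ φ x v) := by
  refine ⟨(hφ.1.fderiv_right (m := ∞) le_rfl).clm_apply contDiff_const,
    hφ.2.1.fderiv_apply ℝ v, ?_⟩
  exact (tsupport_fderiv_apply_subset ℝ v).trans hφ.2.2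

/-- A weak supersolution satisfies the inequality in the sense of distributions. -/
theorem IsWeakSupersolution.le_neg_integral_laplacian {f : ℝ → ℝ}
    {u : EuclideanSpace ℝ (Fin n) → ℝ} (hu : IsWeakSupersolution f Ω u)
    {φ : EuclideanSpace ℝ (Fin n) → ℝ} (hφ : IsTestFunction Ω φ) (hφ0 : ∀ x, 0 ≤ φ x) :
    IntegrableOn (fun x => f (u x) * φ x) Ω ∧
      ∫ x in Ω, f (u x) * φ x ≤ -∫ x in Ω, u x * (Δ φ) x := by
  obtain ⟨hu2, G, hG, hGu, h⟩ := hu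
  refine ⟨(h φ hφ hφ0).1, (h φ hφ hφ0).2.trans (le_of_eq ?_)⟩
  have hφi := fun i : Fin n => hφ.fderiv_apply (EuclideanSpace.single i 1)
  have hφii := fun i : Fin n => (hφi i).fderiv_apply (EuclideanSpace.single i 1)
  have hGi : ∀ i, MemL2Loc Ω fun x => G x i := fun i K hK hKΩ =>
    (EuclideanSpace.proj i : EuclideanSpace ℝ (Fin n) →L[ℝ] ℝ).comp_memLp' (hG K hK hKΩ)
  have h1 : ∀ x, ⟪G x, gradient φ x⟫_ℝ =
      ∑ i, G x i * fderiv ℝ φ x (EuclideanSpace.single i 1) := by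
    intro x
    rw [PiLp.inner_apply]
    refine Finset.sum_congr rfl fun i _ => ?_
    have : gradient φ x i = fderiv ℝ φ x (EuclideanSpace.single i 1) := by
      have h := inner_gradient_left (f := φ) (x := x) (y := EuclideanSpace.single i 1)
      rw [EuclideanSpace.inner_single_right] at h
      simpa only [one_mul, conj_trivial] using h
    rw [this]
    simp [mul_comm]
  have h2 : ∀ x, u x * (Δ φ) x = ∑ i, u x * fderiv ℝ
      (fun y => fderiv ℝ φ y (EuclideanSpace.single i 1)) x (EuclideanSpace.single i 1) := by
    intro x
    rw [(hφ.1.of_le two_le_infty).contDiffAt.laplacian_eq_sum, Finset.mul_sum]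
  simp only [h1, h2]
  rw [integral_finsetSum _ fun i _ =>
      (hGi i).integrableOn_mul (hφi i).1.continuous (hφi i).2.1 (hφi i).2.2,
    integral_finsetSum _ fun i _ =>
      hu2.integrableOn_mul (hφii i).1.continuous (hφii i).2.1 (hφii i).2.2,
    ← Finset.sum_neg_distrib]
  refine Finset.sum_congr rfl fun i _ => ?_
  -- The definition of the weak gradient is used with `∂ᵢφ` as test function.
  rw [hGu _ (hφi i) i, neg_neg]

end WeakForm

/-- Differentiation under the integral sign for the Laplacian of a convolution. -/
theorem laplacian_convolution {n : ℕ} {U g : EuclideanSpace ℝ (Fin n) → ℝ}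
    (hU : LocallyIntegrable U) (hg : ContDiff ℝ 2 g) (hc : HasCompactSupport g)
    (x : EuclideanSpace ℝ (Fin n)) :
    (Δ fun y => ∫ z, U z * g (y - z)) x = ∫ z, U z * (Δ g) (x - z) := by
  -- One derivative moves onto the kernel; this is applied to `g` and then to `∂ᵢg`.
  have key : ∀ {g : EuclideanSpace ℝ (Fin n) → ℝ}, ContDiff ℝ 1 g → HasCompactSupport g →
      ∀ y v, fderiv ℝ (fun y => ∫ z, U z * g (y - z)) y v = ∫ z, U z * fderiv ℝ g (y - z) v := by
    intro g hg hc y v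
    have h := hc.hasFDerivAt_convolution_right (ContinuousLinearMap.mul ℝ ℝ) hU hg y
    have h' := h.fderiv
    have h'' := DFunLike.congr_fun h' v
    rw [convolution_precompR_apply _ hU (hc.fderiv ℝ) (hg.continuous_fderiv one_ne_zero)] at h''
    exact h''
  have hsm : ContDiff ℝ 2 fun y => ∫ z, U z * g (y - z) :=
    hc.contDiff_convolution_right (n := 2) (ContinuousLinearMap.mul ℝ ℝ) hU hg
  have hgi : ∀ v, ContDiff ℝ 1 fun y => fderiv ℝ g y v := fun v =>
    (hg.fderiv_right (m := 1) (by norm_num)).clm_apply contDiff_const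
  rw [hsm.contDiffAt.laplacian_eq_sum]
  simp only [hg.contDiffAt.laplacian_eq_sum, Finset.mul_sum]
  rw [integral_finsetSum]
  · refine Finset.sum_congr rfl fun i _ => ?_
    rw [funext fun y => key (hg.of_le one_le_two) hc y (EuclideanSpace.single i 1)]
    exact key (hgi _) (hc.fderiv_apply ℝ _) x _
  · intro i _
    have h := ((hc.fderiv_apply ℝ (EuclideanSpace.single i 1)).fderiv_apply ℝ
      (EuclideanSpace.single i 1)).convolutionExists_right (ContinuousLinearMap.mul ℝ ℝ) hU
      (((hgi (EuclideanSpace.single i 1)).continuous_fderiv one_ne_zero).clm_apply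
        continuous_const) x
    exact h

/-! ### Mollification: monotonicity in the scale and convergence -/

section Mollify

variable {U : EuclideanSpace ℝ (Fin 2) → ℝ}

/-- The mollification of `U` at scale `t`. -/
noncomputable def mollify (U : EuclideanSpace ℝ (Fin 2) → ℝ) (t : ℝ)
    (x : EuclideanSpace ℝ (Fin 2)) : ℝ :=
  ∫ z, U z * moll t (x - z)

theorem integrable_mul_moll (hU : LocallyIntegrable U) {t : ℝ} (ht : 0 < t)
    (x : EuclideanSpace ℝ (Fin 2)) : Integrable fun z => U z * moll t (x - z) :=
  (hasCompactSupport_moll ht).convolutionExists_right (ContinuousLinearMap.mul ℝ ℝ) hU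
    (contDiff_moll t).continuous x

theorem hasDerivAt_mollify (hU : LocallyIntegrable U) {t : ℝ} (ht : 0 < t)
    (x : EuclideanSpace ℝ (Fin 2)) :
    HasDerivAt (fun s => mollify U s x) (bumpMass⁻¹ * t⁻¹ *
      ∫ z, U z * (Δ fun y => glueIntegral (1 - ‖y - x‖ ^ 2 / t ^ 2)) z) t := by
  -- Bounding the scale by `t + 1` puts the supports of all the kernels in one compact ball.
  have hg : ContDiffOn ℝ 1 (↿moll) (Set.Ioo 0 (t + 1) ×ˢ Set.univ) :=
    contDiffOn_moll_uncurry.mono (Set.prod_mono Set.Ioo_subset_Ioi_self subset_rfl)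
  have hmem : t ∈ Set.Ioo 0 (t + 1) := ⟨ht, by linarith⟩
  have hsupp : ∀ (s : ℝ) (y : EuclideanSpace ℝ (Fin 2)), s ∈ Set.Ioo 0 (t + 1) →
      y ∉ Metric.closedBall (0 : EuclideanSpace ℝ (Fin 2)) (t + 1) → moll s y = 0 := by
    intro s y hs hy
    rw [Metric.mem_closedBall, dist_zero_right, not_le] at hy
    exact moll_eq_zero hs.1 (hs.2.trans hy).le
  have h := hasFDerivAt_convolution_right_with_param (ContinuousLinearMap.mul ℝ ℝ) isOpen_Ioo
    (isCompact_closedBall 0 (t + 1)) hsupp hU hg (t, x) hmem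
  have hl : HasDerivAt (fun s : ℝ => (s, x)) ((1 : ℝ), (0 : EuclideanSpace ℝ (Fin 2))) t :=
    (hasDerivAt_id t).prodMk (hasDerivAt_const t x)
  have hd := h.comp_hasDerivAt t hl
  have hopen : IsOpen (Set.Ioo 0 (t + 1) ×ˢ (Set.univ : Set (EuclideanSpace ℝ (Fin 2)))) :=
    isOpen_Ioo.prod isOpen_univ
  have hcs : HasCompactSupport fun y => fderiv ℝ (↿moll) (t, y) := by
    refine HasCompactSupport.intro (isCompact_closedBall 0 (t + 1)) fun y hy => ?_
    have : (↿moll) =ᶠ[𝓝 (t, y)] fun _ => (0 : ℝ) := by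
      have hn : Set.Ioo 0 (t + 1) ×ˢ (Metric.closedBall (0 : EuclideanSpace ℝ (Fin 2)) (t + 1))ᶜ ∈
          𝓝 (t, y) :=
        (isOpen_Ioo.prod Metric.isClosed_closedBall.isOpen_compl).mem_nhds ⟨hmem, hy⟩
      filter_upwards [hn] with p hp using hsupp p.1 p.2 hp.1 hp.2
    rw [this.fderiv_eq]
    simp
  have hcont : Continuous fun y => fderiv ℝ (↿moll) (t, y) := by
    have := hg.continuousOn_fderiv_of_isOpen hopen le_rfl
    exact this.comp_continuous (by fun_prop) fun y => ⟨hmem, trivial⟩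
  rw [convolution_precompR_apply _ hU hcs hcont] at hd
  refine HasDerivAt.congr_deriv (f := fun s => mollify U s x) hd ?_
  rw [convolution_def, ← integral_const_mul]
  refine integral_congr_ae (ae_of_all _ fun z => ?_)
  have hdiff : DifferentiableAt ℝ (↿moll) (t, x - z) :=
    (hg.contDiffAt (hopen.mem_nhds ⟨hmem, trivial⟩)).differentiableAt one_ne_zero
  have hl' : HasDerivAt (fun s : ℝ => (s, x - z)) ((1 : ℝ), (0 : EuclideanSpace ℝ (Fin 2))) t :=
    (hasDerivAt_id t).prodMk (hasDerivAt_const t _)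
  have h0 : HasDerivAt (fun s => moll s (x - z)) (fderiv ℝ (↿moll) (t, x - z) (1, 0)) t :=
    HasFDerivAt.comp_hasDerivAt (l := ↿moll) t hdiff.hasFDerivAt hl'
  have h1 := h0.unique (hasDerivAt_moll ht x z)
  simp only [ContinuousLinearMap.mul_apply', h1]
  ring

/-- Mollifications at smaller scales of a distributional supersolution are larger. -/
theorem mollify_antitoneOn (hU : LocallyIntegrable U) {R T : ℝ}
    (hsup : ∀ φ : EuclideanSpace ℝ (Fin 2) → ℝ, IsTestFunction {x | R ≤ ‖x‖} φ →
      (∀ x, 0 ≤ φ x) → ∫ z, U z * (Δ φ) z ≤ 0)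
    {x : EuclideanSpace ℝ (Fin 2)} (hx : R + T ≤ ‖x‖) :
    AntitoneOn (fun s => mollify U s x) (Set.Ioc 0 T) := by
  have hd := fun s (hs : s ∈ Set.Ioc 0 T) => hasDerivAt_mollify hU hs.1 x
  refine antitoneOn_of_deriv_nonpos (convex_Ioc 0 T)
    (fun s hs => (hd s hs).continuousAt.continuousWithinAt)
    (fun s hs => (hd s (interior_subset hs)).differentiableAt.differentiableWithinAt)
    fun s hs => ?_
  replace hs := interior_subset hs
  rw [(hd s hs).deriv]
  have hm := bumpMass_pos
  have hs0 : 0 < s := hs.1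
  -- The derivative in the scale is a positive factor times the integral of `U` against the
  -- Laplacian of a nonnegative bump; `R + T ≤ ‖x‖` keeps the bump's support in the admissible
  -- region.
  refine mul_nonpos_of_nonneg_of_nonpos (by positivity) (hsup _ ⟨?_, ?_, ?_⟩ fun z => ?_)
  · exact contDiff_glueIntegral.comp
      (contDiff_const.sub (((contDiff_id.sub contDiff_const).norm_sq ℝ).div_const _))
  · exact (hasCompactSupport_bump hs0 (fun r => glueIntegral_of_nonpos) x).1
  · refine (hasCompactSupport_bump hs0 (fun r => glueIntegral_of_nonpos) x).2.trans fun z hz => ?_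
    have h1 := norm_sub_norm_le x z
    rw [Metric.mem_closedBall, dist_eq_norm, norm_sub_rev] at hz
    change R ≤ ‖z‖
    linarith [hs.2]
  · exact glueIntegral_nonneg _

/-- At a Lebesgue point the mean oscillation over shrinking balls tends to `0`. The mollifier is at
most a constant over the area of its ball, so the error is at most a fixed multiple of that
oscillation. -/
theorem ae_tendsto_mollify (hU : LocallyIntegrable U) :
    ∀ᵐ x, Tendsto (fun t => mollify U t x) (𝓝[>] 0) (𝓝 (U x)) := by
  filter_upwards [IsUnifLocDoublingMeasure.ae_tendsto_average_norm_sub volume hU 1] with x hx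
  have h := hx (fun _ : ℝ => x) (fun t => t) tendsto_id (by
    filter_upwards [self_mem_nhdsWithin] with t (ht : 0 < t)
    simpa using ht.le)
  set C := volume.real (Metric.closedBall (0 : EuclideanSpace ℝ (Fin 2)) 1) with hC
  have h' := h.const_mul (bumpMass⁻¹ * C)
  rw [mul_zero] at h'
  rw [tendsto_iff_norm_sub_tendsto_zero]
  refine squeeze_zero' (Eventually.of_forall fun _ => norm_nonneg _) ?_ h'
  filter_upwards [self_mem_nhdsWithin] with t (ht : 0 < t)
  have hm := bumpMass_pos
  have hint : IntegrableOn (fun z => ‖U z - U x‖) (Metric.closedBall x t) :=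
    ((hU.integrableOn_isCompact (isCompact_closedBall x t)).sub
      (integrableOn_const (isCompact_closedBall x t).measure_lt_top.ne)).norm
  have hmoll : Integrable fun z => moll t (x - z) :=
    ((contDiff_moll t).continuous.integrable_of_hasCompactSupport
      (hasCompactSupport_moll ht)).comp_sub_left x
  have hone : ∫ z, moll t (x - z) = 1 := by
    rw [integral_sub_left_eq_self (moll t), integral_moll ht]
  have hvol : volume.real (Metric.closedBall x t) = t ^ 2 * C := by
    rw [hC, Measure.real, Measure.addHaar_closedBall' _ _ ht.le]
    simp [Measure.real, ENNReal.toReal_mul, ENNReal.toReal_ofReal (sq_nonneg t)]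
  have hC0 : 0 < C :=
    ENNReal.toReal_pos (Metric.measure_closedBall_pos volume _ one_pos).ne'
      (isCompact_closedBall _ _).measure_lt_top.ne
  have hsub : mollify U t x - U x = ∫ z, (U z - U x) * moll t (x - z) := by
    simp only [sub_mul]
    rw [integral_sub (integrable_mul_moll hU ht x) (hmoll.const_mul _), integral_const_mul, hone,
      mul_one]
    rfl
  rw [hsub, setAverage_eq, hvol, smul_eq_mul]
  calc ‖∫ z, (U z - U x) * moll t (x - z)‖ ≤ ∫ z, ‖U z - U x‖ * moll t (x - z) := by
        refine (norm_integral_le_integral_norm _).trans (le_of_eq ?_)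
        refine integral_congr_ae (ae_of_all _ fun z => ?_)
        simp [abs_of_nonneg (moll_nonneg t (x - z))]
    _ = ∫ z in Metric.closedBall x t, ‖U z - U x‖ * moll t (x - z) := by
        refine (setIntegral_eq_integral_of_forall_compl_eq_zero fun z hz => ?_).symm
        rw [Metric.mem_closedBall, dist_eq_norm, norm_sub_rev, not_le] at hz
        rw [moll_eq_zero ht hz.le, mul_zero]
    _ ≤ ∫ z in Metric.closedBall x t, ‖U z - U x‖ * (bumpMass⁻¹ * (t ^ 2)⁻¹) := by
        refine integral_mono_of_nonneg (ae_of_all _ fun z => ?_) (hint.mul_const _)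
          (ae_of_all _ fun z => ?_)
        · exact mul_nonneg (norm_nonneg _) (moll_nonneg _ _)
        · exact mul_le_mul_of_nonneg_left (moll_le _ _) (norm_nonneg _)
    _ = _ := by
        rw [integral_mul_const]
        field_simp

end Mollify

/-! ### Jensen's inequality and weak supersolutions -/

theorem MemL2Loc.locallyIntegrable_indicator {n : ℕ} {Ω : Set (EuclideanSpace ℝ (Fin n))}
    {u : EuclideanSpace ℝ (Fin n) → ℝ} (hu : MemL2Loc Ω u) {S : Set (EuclideanSpace ℝ (Fin n))}
    (hS : IsClosed S) (hSΩ : S ⊆ Ω) : LocallyIntegrable (S.indicator u) := by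
  rw [locallyIntegrable_iff]
  intro K hK
  have h := hu.integrableOn (hK.inter_right hS) (Set.inter_subset_right.trans hSΩ)
  rw [IntegrableOn, integrable_indicator_iff hS.measurableSet, IntegrableOn,
    Measure.restrict_restrict hS.measurableSet, Set.inter_comm]
  exact h

theorem integral_mul_moll_pos {U : EuclideanSpace ℝ (Fin 2) → ℝ} (hU : LocallyIntegrable U)
    {t : ℝ} (ht : 0 < t) {x : EuclideanSpace ℝ (Fin 2)}
    (hpos : ∀ᵐ z, z ∈ Metric.closedBall x t → 0 < U z) : 0 < mollify U t x := by
  have hout : ∀ z, z ∉ Metric.closedBall x t → moll t (x - z) = 0 := fun z hz => by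
    rw [Metric.mem_closedBall, dist_eq_norm, norm_sub_rev, not_le] at hz
    exact moll_eq_zero ht hz.le
  have hnn : 0 ≤ᵐ[volume] fun z => U z * moll t (x - z) := by
    filter_upwards [hpos] with z hz
    by_cases h : z ∈ Metric.closedBall x t
    · exact mul_nonneg (hz h).le (moll_nonneg _ _)
    · simp [hout z h]
  rw [mollify, integral_pos_iff_support_of_nonneg_ae hnn (integrable_mul_moll hU ht x)]
  refine (Metric.measure_ball_pos volume x ht).trans_le (measure_mono_ae ?_)
  filter_upwards [hpos] with z hz hzx
  have hzx' : ‖x - z‖ < t := by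
    rw [← dist_eq_norm, dist_comm]
    exact hzx
  exact (mul_pos (hz (Metric.ball_subset_closedBall hzx)) (moll_pos hzx')).ne'

theorem isTestFunction_moll {x : EuclideanSpace ℝ (Fin 2)} {R : ℝ} (hx : R + 1 ≤ ‖x‖) :
    IsTestFunction {z : EuclideanSpace ℝ (Fin 2) | R ≤ ‖z‖} (fun z => moll 1 (x - z)) := by
  have h : ∀ z, z ∉ Metric.closedBall x 1 → moll 1 (x - z) = 0 := fun z hz => by
    rw [Metric.mem_closedBall, dist_eq_norm, norm_sub_rev, not_le] at hz
    exact moll_eq_zero one_pos hz.le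
  refine ⟨(contDiff_moll 1).comp (contDiff_const.sub contDiff_id),
    HasCompactSupport.intro (isCompact_closedBall x 1) h, ?_⟩
  refine Set.Subset.trans (b := Metric.closedBall x 1)
    (closure_minimal (fun z hz => ?_) Metric.isClosed_closedBall) fun z hz => ?_
  · by_contra h'
    exact hz (h z h')
  · have h1 := norm_sub_norm_le x z
    rw [Metric.mem_closedBall, dist_eq_norm, norm_sub_rev] at hz
    change R ≤ ‖z‖
    linarith

/-- Jensen's inequality for the convex function `s ↦ c exp(-a s)` and a mollifier. -/
theorem exp_mollify_le {U F : EuclideanSpace ℝ (Fin 2) → ℝ} (hU : LocallyIntegrable U)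
    {t a c : ℝ} (ht : 0 < t) (hc : 0 ≤ c) {x : EuclideanSpace ℝ (Fin 2)}
    (hF : Integrable fun z => F z * moll t (x - z))
    (hUF : ∀ᵐ z, z ∈ Metric.closedBall x t → c * Real.exp (-a * U z) ≤ F z) :
    c * Real.exp (-a * mollify U t x) ≤ ∫ z, F z * moll t (x - z) := by
  set w := mollify U t x with hw
  set E := c * Real.exp (-a * w) with hE
  have hm : Integrable fun z => moll t (x - z) :=
    ((contDiff_moll t).continuous.integrable_of_hasCompactSupport
      (hasCompactSupport_moll ht)).comp_sub_left x
  have hone : ∫ z, moll t (x - z) = 1 := by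
    rw [integral_sub_left_eq_self (moll t), integral_moll ht]
  have hUm := integrable_mul_moll hU ht x
  -- The integrand is the tangent line of `s ↦ c exp(-a s)` at the mean `w`, evaluated at `U z` and
  -- weighted by the mollifier; its average is the value at `w`.
  have heq : ∫ z, (E * (1 + a * w) * moll t (x - z) - E * a * (U z * moll t (x - z))) = E := by
    rw [integral_sub (hm.const_mul _) (hUm.const_mul _), integral_const_mul, integral_const_mul,
      hone]
    change E * (1 + a * w) * 1 - E * a * w = E
    ring
  rw [← heq]
  refine integral_mono_ae ((hm.const_mul _).sub (hUm.const_mul _)) hF ?_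
  filter_upwards [hUF] with z hz
  by_cases h : z ∈ Metric.closedBall x t
  · have h1 : E * (1 + a * w - a * U z) ≤ F z := by
      refine le_trans ?_ (hz h)
      have h2 : c * Real.exp (-a * U z) = E * Real.exp (a * w - a * U z) := by
        rw [hE, mul_assoc, ← Real.exp_add]
        ring_nf
      rw [h2]
      refine mul_le_mul_of_nonneg_left ?_ (mul_nonneg hc (Real.exp_pos _).le)
      linarith [Real.add_one_le_exp (a * w - a * U z)]
    have h3 := mul_le_mul_of_nonneg_right h1 (moll_nonneg t (x - z))
    refine le_trans (le_of_eq ?_) h3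
    ring
  · rw [Metric.mem_closedBall, dist_eq_norm, norm_sub_rev, not_le] at h
    simp [moll_eq_zero ht h.le]

theorem IsWeakSupersolution.not_ae_pos {f : ℝ → ℝ} {Ω : Set (EuclideanSpace ℝ (Fin 2))}
    {u : EuclideanSpace ℝ (Fin 2) → ℝ} (hf_cont : ContinuousOn f (Set.Ioi 0))
    (hf_pos : ∀ s, 0 < s → 0 < f s)
    (hf_lim : ∀ a : ℝ, 0 < a → Tendsto (fun s => Real.exp (a * s) * f s) atTop atTop)
    (hΩ : IsExteriorDomain Ω) (hu : IsWeakSupersolution f Ω u) :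
    ¬ ∀ᵐ x ∂(volume.restrict Ω), 0 < u x := by
  intro hpos
  rw [ae_restrict_iff' hΩ.1.measurableSet] at hpos
  obtain ⟨R, hR, hRΩ⟩ := hΩ.exists_radius
  set S : Set (EuclideanSpace ℝ (Fin 2)) := {z | R ≤ ‖z‖} with hS
  have hSc : IsClosed S := isClosed_le continuous_const continuous_norm
  have hSΩ : S ⊆ Ω := fun z hz => hRΩ z hz
  -- Nothing is known of `u` outside `Ω`; truncating to a closed subset of `Ω` gives a function
  -- locally integrable on the whole plane, which can be convolved.
  set U := S.indicator u with hUdef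
  have hUu : ∀ z ∈ S, U z = u z := fun z hz => Set.indicator_of_mem hz u
  have hU : LocallyIntegrable U := hu.1.locallyIntegrable_indicator hSc hSΩ
  have hball : ∀ {x : EuclideanSpace ℝ (Fin 2)} {r : ℝ}, r + 1 ≤ ‖x‖ →
      ∀ z ∈ Metric.closedBall x 1, r ≤ ‖z‖ := fun {x r} hx z hz => by
    have h1 := norm_sub_norm_le x z
    rw [Metric.mem_closedBall, dist_eq_norm, norm_sub_rev] at hz
    linarith
  have hweak : ∀ φ : EuclideanSpace ℝ (Fin 2) → ℝ, IsTestFunction S φ → (∀ x, 0 ≤ φ x) →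
      Integrable (fun z => f (u z) * φ z) ∧
      ∫ z, f (u z) * φ z ≤ -∫ z, U z * (Δ φ) z := by
    intro φ hφ hφ0
    have hφz : ∀ z, z ∉ S → φ z = 0 := fun z hz =>
      image_eq_zero_of_notMem_tsupport fun h => hz (hφ.2.2 h)
    obtain ⟨h1, h2⟩ := hu.le_neg_integral_laplacian ⟨hφ.1, hφ.2.1, hφ.2.2.trans hSΩ⟩ hφ0
    refine ⟨?_, ?_⟩
    · refine (integrableOn_iff_integrable_of_support_subset fun z hz => ?_).1 h1
      by_contra h
      exact hz (by simp [hφz z fun h' => h (hSΩ h')])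
    · rw [setIntegral_eq_integral_of_forall_compl_eq_zero fun z hz => by
        rw [hφz z fun h => hz (hSΩ h), mul_zero]] at h2
      refine h2.trans (neg_le_neg (le_of_eq ?_))
      have hΔ : ∀ z, z ∉ S → (Δ φ) z = 0 := by
        intro z hz
        have h : φ =ᶠ[𝓝 z] fun _ => (0 : ℝ) :=
          notMem_tsupport_iff_eventuallyEq.1 fun h => hz (hφ.2.2 h)
        rw [(InnerProductSpace.laplacian_congr_nhds h).eq_of_nhds]
        simp
      rw [← integral_indicator hΩ.1.measurableSet]
      refine integral_congr_ae (ae_of_all _ fun z => ?_)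
      by_cases hz : z ∈ S
      · simp [hUu z hz, hSΩ hz]
      · have h0 : Ω.indicator (fun x => u x * (Δ φ) x) z = 0 :=
          Set.indicator_apply_eq_zero.2 fun _ => by rw [hΔ z hz, mul_zero]
        exact (by simp [hΔ z hz] : U z * (Δ φ) z = 0).trans h0.symm
  have hfφ : ∀ φ : EuclideanSpace ℝ (Fin 2) → ℝ, IsTestFunction S φ → (∀ x, 0 ≤ φ x) →
      0 ≤ ∫ z, f (u z) * φ z := by
    intro φ hφ hφ0
    refine integral_nonneg_of_ae ?_
    filter_upwards [hpos] with z hz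
    by_cases h : z ∈ Ω
    · exact mul_nonneg (hf_pos _ (hz h)).le (hφ0 z)
    · have : φ z = 0 := image_eq_zero_of_notMem_tsupport fun h' => h (hSΩ (hφ.2.2 h'))
      simp [this]
  set w := mollify U 1 with hw
  have hwsm : ContDiff ℝ 2 w :=
    (hasCompactSupport_moll one_pos).contDiff_convolution_right (n := 2)
      (ContinuousLinearMap.mul ℝ ℝ) hU ((contDiff_moll 1).of_le two_le_infty)
  have hΔw : ∀ x, R + 1 ≤ ‖x‖ → ∫ z, f (u z) * moll 1 (x - z) ≤ -(Δ w) x := by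
    intro x hx
    refine ((hweak _ (isTestFunction_moll hx) fun z => moll_nonneg _ _).2).trans
      (neg_le_neg (le_of_eq ?_))
    rw [hw]
    change (Δ fun y => ∫ z, U z * moll 1 (y - z)) x = _
    rw [laplacian_convolution hU ((contDiff_moll 1).of_le two_le_infty)
      (hasCompactSupport_moll one_pos)]
    have h : (fun z => moll 1 (x - z)) = fun z => mollProfile 1 (‖z - x‖ ^ 2) := by
      funext z
      rw [norm_sub_rev]
      rfl
    rw [h]
    simp only [laplacian_mollProfile]
  have hwpos : ∀ x, R + 1 ≤ ‖x‖ → 0 < w x := fun x hx =>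
    integral_mul_moll_pos hU one_pos (by
      filter_upwards [hpos] with z hz hzx
      have hzS : z ∈ S := hball hx z hzx
      rw [hUu z hzS]
      exact hz (hSΩ hzS))
  have hexp : ∀ {r : ℝ}, 0 < r → ∀ x : EuclideanSpace ℝ (Fin 2),
      Real.exp (Real.log (r ^ 2)) ≤ ‖x‖ ^ 2 ↔ r ≤ ‖x‖ := fun {r} hr x => by
    rw [Real.exp_log (by positivity), sq_le_sq₀ hr.le (norm_nonneg _)]
  obtain ⟨b, hb, hbw⟩ := exists_pos_le_of_superharmonic (u := w) (t := Real.log ((R + 1) ^ 2))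
    hwsm.continuous.continuousOn.lowerSemicontinuousOn
    (fun x hx => hwpos x ((hexp (by linarith) x).1 hx))
    fun x hx => by
      have hx' := (hexp (by linarith) x).1 hx.le
      exact hwsm.contDiffAt.viscosityBoundAt.mono
        ((hfφ _ (isTestFunction_moll hx') fun z => moll_nonneg _ _).trans (hΔw x hx'))
  -- Almost everywhere `u` is the limit of mollifications at scales `t → 0`, each at least the one
  -- at scale `1`, hence at least `b`.
  have hub : ∀ᵐ z, R + 1 ≤ ‖z‖ → b ≤ u z := by
    filter_upwards [ae_tendsto_mollify hU] with z hz hzR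
    rw [← hUu z (by change R ≤ ‖z‖; linarith)]
    refine ge_of_tendsto hz ?_
    filter_upwards [Ioc_mem_nhdsGT (one_pos (α := ℝ))] with t ht
    refine (hbw z ((hexp (by linarith) z).2 hzR)).trans ?_
    refine mollify_antitoneOn hU (R := R) (T := 1) (fun φ hφ hφ0 => ?_) hzR ht
      ⟨one_pos, le_rfl⟩ ht.2
    linarith [(hweak φ hφ hφ0).2, hfφ φ hφ hφ0]
  -- The radius `R + 2` ensures that the unit ball around `x` stays in `R + 1 ≤ ‖z‖`, where `b ≤ u`
  -- holds almost everywhere.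
  refine false_of_exp_bound (u := w) (t := Real.log ((R + 2) ^ 2))
    hwsm.continuous.continuousOn.lowerSemicontinuousOn
    (fun x hx => hwpos x (by linarith [(hexp (by linarith) x).1 hx])) fun a ha => ?_
  obtain ⟨c, hc, hcf⟩ := exists_exp_le hf_cont hf_pos hf_lim ha hb
  refine ⟨c, hc, fun x hx => ?_⟩
  have hx' : R + 2 ≤ ‖x‖ := (hexp (by linarith) x).1 hx.le
  have hx1 : R + 1 ≤ ‖x‖ := by linarith
  refine hwsm.contDiffAt.viscosityBoundAt.mono (le_trans ?_ (hΔw x hx1))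
  refine exp_mollify_le hU one_pos hc.le
    (hweak _ (isTestFunction_moll hx1) fun z => moll_nonneg _ _).1 ?_
  filter_upwards [hub] with z hz hzx
  have hzR : R + 1 ≤ ‖z‖ := hball (by linarith) z hzx
  rw [hUu z (by change R ≤ ‖z‖; linarith)]
  exact hcf _ (hz hzR)

theorem theorem2p2 (f : ℝ → ℝ) (hf_cont : ContinuousOn f (Set.Ioi 0))
    (hf_pos : ∀ s, 0 < s → 0 < f s)
    (hf_lim : ∀ a : ℝ, 0 < a → Tendsto (fun s => Real.exp (a * s) * f s) atTop atTop)
    (Ω : Set (EuclideanSpace ℝ (Fin 2))) (hΩ : IsExteriorDomain Ω) :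
    (¬ ∃ u : EuclideanSpace ℝ (Fin 2) → ℝ,
      (∀ x ∈ Ω, 0 < u x) ∧ IsClassicalSupersolution f Ω u) ∧
    (¬ ∃ u : EuclideanSpace ℝ (Fin 2) → ℝ,
      (∀ᵐ x ∂(volume.restrict Ω), 0 < u x) ∧ IsWeakSupersolution f Ω u) ∧
    (¬ ∃ u : EuclideanSpace ℝ (Fin 2) → ℝ,
      (∀ x ∈ Ω, 0 < u x) ∧ IsViscositySupersolution f Ω u) :=
  ⟨fun ⟨_, hpos, hu⟩ => hu.not_pos hf_cont hf_pos hf_lim hΩ hpos,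
    fun ⟨_, hpos, hu⟩ => hu.not_ae_pos hf_cont hf_pos hf_lim hΩ hpos,
    fun ⟨_, hpos, hu⟩ => hu.not_pos hf_cont hf_pos hf_lim hΩ hpos⟩
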